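/- Let $d\ge 1$, $r_1,\dots,r_d\in\mathbb N$, $\mathcal R=[r_1]\times\cdots\times[r_d]$, and for each $\ell$ let $x^{(\ell)}_1<\dots<x^{(\ell)}_{r_\ell}$ be reals. For an array $a=(a_{\mathbf i})_{\mathbf i\in\mathcal R}$ write $a^{(\ell)}_i=\sum_{\mathbf j\in\mathcal R:\,j_\ell=i}a_{\mathbf j}$ for its margins and $\underline a=\mathrm{vec}(a)\in\mathbb R^{\prod_\ell r_\ell}$ for its column-major vectorisation. Let $P$ be a probability measure on the grid $\prod_\ell\{x^{(\ell)}_1,\dots,x^{(\ell)}_{r_\ell}\}$ whose probability array $p_{\mathbf i}=P(\{(x^{(1)}_{i_1},\dots,x^{(d)}_{i_d})\})$ has full support: $p_{\mathbf i}>0$ for all $\mathbf i\in\mathcal R$. Let $\Gamma$ be the set of probability arrays $\gamma$ with uniform margins, $\gamma^{(\ell)}_i=1/r_\ell$ for all $\ell,i$. The copula array of a probability array $p$ is its $\mathcal I$-projection on $\Gamma$, $\gamma_p=\arg\min_{\gamma\in\Gamma}\mathcal I(\gamma\|p)$, where $\mathcal I(q\|p)=\sum_{\mathbf i:\,p_{\mathbf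 i}\ne 0}q_{\mathbf i}\log(q_{\mathbf i}/p_{\mathbf i})$ if $\mathrm{Supp}(q)\subseteq\mathrm{Supp}(p)$ and $\mathcal I(q\|p)=\infty$ otherwise. Let $\mathbf X_1,\mathbf X_2,\dots$ be random vectors on a common probability space, each with law $P$ (not necessarily independent), and put $$\hat p_n=\frac{n}{n+1}\,p_n+\frac1{n+1}\,q,\qquad p_{\mathbf i;n}=\frac1n\sum_{k=1}^n\mathbf 1\{\mathbf X_k=(x^{(1)}_{i_1},\dots,x^{(d)}_{i_d})\},\qquad q_{\mathbf i}=\frac1{|\mathcal R|},$$ and $\hat\gamma_n=\gamma_{\hat p_n}$. Let $A_{\mathcal R}$ be a matrix whose columns are the vectorised elements of an arbitrary basis of the linear space of all arrays $a\in\mathbb R^{r_1\times\cdots\times r_d}$ with $a^{(\ell)}_i=0$ for all $\ell$ and $i$. Then $\gamma_p$ exists, is unique and has support $\mathcal R$; almost surely $\hat\gamma_n$ exists and is unique for all $n$; the matrix $A_{\mathcal R}^{\top}\mathrm{diag}^{-1}(\underline\gamma_p)A_{\mathcal R}$ is invertible; and if $$\sqrt n\,(\underline{\hat p}_n-\underline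 p)\ \xrightarrow{\ \mathcal L\ }\ \mathcal N\bigl(0,\ \mathrm{diag}(\underline p)-\underline p\,\underline p^{\top}\bigr)\qquad(n\to\infty),\tag{$*$}$$ then $$\sqrt n\,(\underline{\hat\gamma}_n-\underline\gamma_p)\ \xrightarrow{\ \mathcal L\ }\ \mathcal N(0,\Sigma_\gamma)\qquad(n\to\infty),$$ where $$\Sigma_\gamma=A_{\mathcal R}\bigl[A_{\mathcal R}^{\top}\mathrm{diag}^{-1}(\underline\gamma_p)A_{\mathcal R}\bigr]^{-1}\bigl[A_{\mathcal R}^{\top}\mathrm{diag}^{-1}(\underline p)A_{\mathcal R}\bigr]\bigl[A_{\mathcal R}^{\top}\mathrm{diag}^{-1}(\underline\gamma_p)A_{\mathcal R}\bigr]^{-1}A_{\mathcal R}^{\top}$$ is positive semidefinite. If $\mathbf X_1,\mathbf X_2,\dots$ are independent, then $(*)$ holds, so that the conclusion applies. -/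

import Mathlib

open MeasureTheory ProbabilityTheory Filter
open scoped BigOperators Topology Matrix

noncomputable section

namespace DiscreteCopula

/-- The set `[r₁] × ⋯ × [r_d]` of multi-indices (indices start at `0`). -/
abbrev MultiIndex {d : ℕ} (r : Fin d → ℕ) : Type := (l : Fin d) → Fin (r l)

/-- Real arrays of size `r₁ × ⋯ × r_d`. -/
abbrev RealArray {d : ℕ} (r : Fin d → ℕ) : Type := MultiIndex r → ℝ

variable {d : ℕ} {r : Fin d → ℕ}

open Classical in
/-- The support of an array. -/
def arraySupport (a : RealArray r) : Finset (MultiIndex r) :=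
  Finset.univ.filter fun i => a i ≠ 0

/-- The `i`-th component of the `l`-th margin: the sum of all entries whose `l`-th index is `i`. -/
def margin (a : RealArray r) (l : Fin d) (i : Fin (r l)) : ℝ :=
  ∑ j : MultiIndex r with j l = i, a j

/-- The probability arrays without identically null slices. -/
def probArrays (r : Fin d → ℕ) : Set (RealArray r) :=
  {p | (∀ i, p i ∈ Set.Icc (0 : ℝ) 1) ∧ ∑ i, p i = 1 ∧ ∀ l i, 0 < margin p l i}

/-- The Fréchet class of the probability arrays with margins `q`. -/
def frechetClass (q : (l : Fin d) → Fin (r l) → ℝ) : Set (RealArray r) :=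
  {p | p ∈ probArrays r ∧ ∀ l, margin p l = q l}

/-- The copula arrays: probability arrays all of whose margins are uniform. -/
def copulaArrays (r : Fin d → ℕ) : Set (RealArray r) :=
  frechetClass fun l _ => 1 / (r l : ℝ)

/-- The `I`-divergence (Kullback-Leibler divergence) of `q` with respect to `p`.
The convention `0 log 0 = 0` is built into the product with `q i = 0`. -/
def iDivergence (q p : RealArray r) : EReal :=
  open Classical in
  if arraySupport q ⊆ arraySupport p then
    ((∑ i ∈ arraySupport p, q i * Real.log (q i / p i) : ℝ) : EReal)
  else ⊤

/-- `q` is an `I`-projection of `p` on the class `F`. -/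
def IsIProjection (F : Set (RealArray r)) (p q : RealArray r) : Prop :=
  q ∈ F ∧ iDivergence q p = ⨅ q' ∈ F, iDivergence q' p

/-- The copula array of `p`: its `I`-projection on the set of copula arrays
(meaningful when that projection exists and is unique). -/
def copulaArray (p : RealArray r) : RealArray r :=
  Classical.epsilon fun g => IsIProjection (copulaArrays r) p g

/-- The space of the arrays that vanish off `S` and have all their margins null. -/
def nullMarginArrays (S : Finset (MultiIndex r)) : Submodule ℝ (RealArray r) where
  carrier := {a | arraySupport a ⊆ S ∧ ∀ l i, margin a l i = 0}
  zero_mem' := by simp [arraySupport, margin]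
  add_mem' := by
    rintro a b ⟨ha, ha'⟩ ⟨hb, hb'⟩
    refine ⟨fun i hi => ?_, fun l i => ?_⟩
    · by_contra hS
      have h1 : a i = 0 := by
        by_contra h
        exact hS (ha (by simpa [arraySupport] using h))
      have h2 : b i = 0 := by
        by_contra h
        exact hS (hb (by simpa [arraySupport] using h))
      simp [arraySupport, h1, h2] at hi
    · have h1 := ha' l i
      have h2 := hb' l i
      simp only [margin] at h1 h2 ⊢
      simp [Finset.sum_add_distrib, h1, h2]
  smul_mem' := by
    rintro c a ⟨ha, ha'⟩
    refine ⟨fun i hi => ha ?_, fun l i => ?_⟩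
    · simp only [arraySupport, Finset.mem_filter, Finset.mem_univ, true_and, Pi.smul_apply,
        smul_eq_mul, ne_eq, mul_eq_zero, not_or] at hi ⊢
      exact hi.2
    · have h1 := ha' l i
      simp only [margin] at h1 ⊢
      simp [← Finset.mul_sum, h1]

/-- Column-major vectorisation of an array; `finPiFinEquiv` sends `(i₁, …, i_d)` to
`∑ l, i_l * ∏ l' < l, r_l'`. -/
def vec (a : RealArray r) : EuclideanSpace ℝ (Fin (∏ l, r l)) :=
  WithLp.toLp 2 fun j => a (finPiFinEquiv.symm j)

/-- The matrix whose columns are the vectorised elements of a basis of `nullMarginArrays S`. -/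
def basisMatrix {S : Finset (MultiIndex r)} {k : ℕ}
    (b : Module.Basis (Fin k) ℝ (nullMarginArrays S)) : Matrix (Fin (∏ l, r l)) (Fin k) ℝ :=
  Matrix.of fun j c => vec (b c : RealArray r) j

/-- The matrix `Aᵀ diag⁻¹(v) A`. -/
def weightedGram {m k : ℕ} (A : Matrix (Fin m) (Fin k) ℝ) (v : EuclideanSpace ℝ (Fin m)) :
    Matrix (Fin k) (Fin k) ℝ :=
  Aᵀ * (Matrix.diagonal fun j => v j)⁻¹ * A

/-- The matrix `A [Aᵀ diag⁻¹(g) A]⁻¹ [Aᵀ diag⁻¹(p) A] [Aᵀ diag⁻¹(g) A]⁻¹ Aᵀ`. -/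
def sandwichCov {m k : ℕ} (A : Matrix (Fin m) (Fin k) ℝ) (g p : EuclideanSpace ℝ (Fin m)) :
    Matrix (Fin m) (Fin m) ℝ :=
  A * (weightedGram A g)⁻¹ * weightedGram A p * (weightedGram A g)⁻¹ * Aᵀ

/-- The matrix `diag(p) - p pᵀ`. -/
def multinomialCov {m : ℕ} (p : EuclideanSpace ℝ (Fin m)) : Matrix (Fin m) (Fin m) ℝ :=
  (Matrix.diagonal fun j => p j) - Matrix.vecMulVec (fun j => p j) (fun j => p j)

/-- The point `(x^{(1)}_{i₁}, …, x^{(d)}_{i_d})` of the grid spanned by the values `x l`. -/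
def gridPoint (x : (l : Fin d) → Fin (r l) → ℝ) (i : MultiIndex r) : Fin d → ℝ :=
  fun l => x l (i l)

/-- The probability array of a measure carried by the grid. -/
def probArray (x : (l : Fin d) → Fin (r l) → ℝ) (P : Measure (Fin d → ℝ)) : RealArray r :=
  fun i => P.real {gridPoint x i}

/-- The array that is uniform on `S` and null elsewhere. -/
def uniformArray (S : Finset (MultiIndex r)) : RealArray r :=
  fun i => open Classical in if i ∈ S then 1 / (S.card : ℝ) else 0

/-- The empirical probability array of the observations `X 0, …, X (n - 1)`. -/
def empiricalArray (x : (l : Fin d) → Fin (r l) → ℝ) {Ω : Type*} (X : ℕ → Ω → Fin d → ℝ)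
    (n : ℕ) (ω : Ω) : RealArray r :=
  fun i => 1 / (n : ℝ) *
    ∑ k ∈ Finset.range n, open Classical in if X k ω = gridPoint x i then (1 : ℝ) else 0

/-- The smoothed empirical probability array: the mixture of the empirical probability array
and of the uniform array on `S` with weights `n / (n + 1)` and `1 / (n + 1)`. -/
def smoothedArray (S : Finset (MultiIndex r)) (x : (l : Fin d) → Fin (r l) → ℝ) {Ω : Type*}
    (X : ℕ → Ω → Fin d → ℝ) (n : ℕ) (ω : Ω) : RealArray r :=
  fun i => (n : ℝ) / (n + 1) * empiricalArray x X n ω i + 1 / ((n : ℝ) + 1) * uniformArray S i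

/-- The empirical copula array: the copula array of the smoothed empirical probability array. -/
def empiricalCopulaArray (S : Finset (MultiIndex r)) (x : (l : Fin d) → Fin (r l) → ℝ)
    {Ω : Type*} (X : ℕ → Ω → Fin d → ℝ) (n : ℕ) (ω : Ω) : RealArray r :=
  copulaArray (smoothedArray S x X n ω)

/-- `√n (V n - v)` converges in distribution to the centred normal law with covariance `C`. -/
def RootNAsymptoticNormal {m : ℕ} {Ω : Type*} [MeasurableSpace Ω] (μ : Measure Ω)
    [IsProbabilityMeasure μ] (V : ℕ → Ω → EuclideanSpace ℝ (Fin m))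
    (v : EuclideanSpace ℝ (Fin m)) (C : Matrix (Fin m) (Fin m) ℝ) : Prop :=
  C.PosSemidef ∧
  TendstoInDistribution (fun (n : ℕ) ω => Real.sqrt n • (V n ω - v)) atTop
    (id : EuclideanSpace ℝ (Fin m) → EuclideanSpace ℝ (Fin m)) (fun _ => μ)
    (multivariateGaussian 0 C)

end DiscreteCopula

end

noncomputable section

namespace DiscreteCopula

/-! ### Existence, positivity and uniqueness of the `I`-projection -/

section

variable {d : ℕ} {r : Fin d → ℕ}

/-! The copula arrays form a compact convex set on which the relative entropy to a positive `p` is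
continuous, so a minimiser `g` exists. The slope of `s log s` is `-∞` at `0`, which forces all
entries of `g` to be positive (`IsIProjection.pos`). Hence `g` may be perturbed along every
null-margin array, in both directions, and `log (g / p)` is orthogonal to all of them. Conversely, a
positive copula array with this property is the only minimiser, by Gibbs' inequality
(`IsStationary.relEntropy_lt`).

With `g = u + A θ`, stationarity reads `Aᵀ (log (u + A θ) - log p) = 0`. Its derivative in `θ` is
the Gram matrix `G = Aᵀ diag⁻¹(g) A`, positive definite since `A` is injective. The implicit
function theorem makes `p ↦ g` differentiable with Jacobian `J = A G⁻¹ Aᵀ diag⁻¹(p)`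
(`hasFDerivAt_vec_copulaArray`).

The delta method then yields a normal limit with covariance `J (diag p - p pᵀ) Jᵀ`. Null-margin
arrays have total sum zero, so `Aᵀ 1 = 0`; the rank-one term disappears and the sandwich form
remains. For independent observations, the premise is the multivariate central limit theorem for the
cell indicators; smoothing only adds a term of order `1 / √n`. -/

lemma sum_margin (a : RealArray r) (l : Fin d) : ∑ i, margin a l i = ∑ j, a j :=
  Finset.sum_fiberwise _ _ _

lemma margin_add (a b : RealArray r) (l : Fin d) (i : Fin (r l)) :
    margin (a + b) l i = margin a l i + margin b l i := by
  simp [margin, Finset.sum_add_distrib]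

lemma margin_smul (c : ℝ) (a : RealArray r) (l : Fin d) (i : Fin (r l)) :
    margin (c • a) l i = c * margin a l i := by
  simp [margin, Finset.mul_sum]

lemma margin_sub (a b : RealArray r) (l : Fin d) (i : Fin (r l)) :
    margin (a - b) l i = margin a l i - margin b l i := by
  simp [margin, Finset.sum_sub_distrib]

lemma continuous_margin (l : Fin d) (i : Fin (r l)) :
    Continuous fun a : RealArray r => margin a l i := by
  unfold margin
  fun_prop

lemma mem_nullMarginArrays_univ {a : RealArray r} :
    a ∈ nullMarginArrays (Finset.univ : Finset (MultiIndex r)) ↔ ∀ l i, margin a l i = 0 :=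
  ⟨fun h => h.2, fun h => ⟨Finset.subset_univ _, h⟩⟩

lemma sum_eq_zero_of_mem_nullMarginArrays (hd : 1 ≤ d) {a : RealArray r}
    (ha : a ∈ nullMarginArrays (Finset.univ : Finset (MultiIndex r))) : ∑ i, a i = 0 := by
  rw [← sum_margin a ⟨0, hd⟩]
  exact Finset.sum_eq_zero fun i _ => mem_nullMarginArrays_univ.1 ha _ _

/-- The total mass is the sum of any one margin, so `1 ≤ d` makes the remaining constraints
automatic. -/
lemma mem_copulaArrays_iff (hd : 1 ≤ d) (hr : ∀ l, 0 < r l) {q : RealArray r} :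
    q ∈ copulaArrays r ↔ (∀ i, 0 ≤ q i) ∧ ∀ l i, margin q l i = 1 / (r l : ℝ) := by
  constructor
  · rintro ⟨⟨h1, -, -⟩, h4⟩
    exact ⟨fun i => (h1 i).1, fun l i => congrFun (h4 l) i⟩
  · rintro ⟨h1, h2⟩
    have hs : ∑ i, q i = 1 := by
      have : (r ⟨0, hd⟩ : ℝ) ≠ 0 := by exact_mod_cast (hr _).ne'
      rw [← sum_margin q ⟨0, hd⟩]
      simp [h2, this]
    refine ⟨⟨fun i => ⟨h1 i, ?_⟩, hs, fun l i => ?_⟩, fun l => funext fun i => h2 l i⟩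
    · rw [← hs]
      exact Finset.single_le_sum (fun j _ => h1 j) (Finset.mem_univ i)
    · have : (0 : ℝ) < r l := by exact_mod_cast hr l
      rw [h2]
      positivity

lemma sub_mem_nullMarginArrays {g q : RealArray r} (hg : g ∈ copulaArrays r)
    (hq : q ∈ copulaArrays r) :
    q - g ∈ nullMarginArrays (Finset.univ : Finset (MultiIndex r)) := by
  rw [mem_nullMarginArrays_univ]
  intro l i
  rw [margin_sub, congrFun (hg.2 l) i, congrFun (hq.2 l) i, sub_self]

/-- The array with constant entries and total mass one. -/
def constArray (r : Fin d → ℕ) : RealArray r := fun _ => ∏ l, (1 / (r l : ℝ))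

lemma constArray_pos (hr : ∀ l, 0 < r l) (i : MultiIndex r) : 0 < constArray r i := by
  refine Finset.prod_pos fun l _ => ?_
  have : (0 : ℝ) < r l := by exact_mod_cast hr l
  positivity

lemma constArray_mem (hd : 1 ≤ d) (hr : ∀ l, 0 < r l) : constArray r ∈ copulaArrays r := by
  classical
  rw [mem_copulaArrays_iff hd hr]
  refine ⟨fun i => (constArray_pos hr i).le, fun l i => ?_⟩
  -- A slice is a product set, so the sum factorises: the factor at `l` is `1 / r l`, every other
  -- one is `1`.
  have hset : (Finset.univ.filter fun j : MultiIndex r => j l = i) =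
      Fintype.piFinset (Function.update (fun l' => (Finset.univ : Finset (Fin (r l')))) l {i}) := by
    ext j
    simp only [Finset.mem_filter, Finset.mem_univ, true_and, Fintype.mem_piFinset]
    constructor
    · intro h l'
      by_cases hl : l' = l
      · subst hl; simp [h]
      · simp [hl]
    · intro h
      simpa using h l
  have hr' : ∀ l, (r l : ℝ) ≠ 0 := fun l => by exact_mod_cast (hr l).ne'
  unfold margin constArray
  rw [hset, Finset.sum_const, Fintype.card_piFinset, nsmul_eq_mul, Nat.cast_prod,
    ← Finset.prod_mul_distrib, Finset.prod_eq_single l]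
  · simp
  · intro l' _ hl
    simp [hl, hr']
  · simp

/-- The relative entropy of `q` with respect to `p`, as a real number. -/
def relEntropy (q p : RealArray r) : ℝ := ∑ i, q i * Real.log (q i / p i)

lemma arraySupport_eq_univ_iff {p : RealArray r} :
    arraySupport p = Finset.univ ↔ ∀ i, p i ≠ 0 := by
  simp [arraySupport, Finset.filter_eq_self]

lemma iDivergence_eq_relEntropy {p : RealArray r} (hp : ∀ i, 0 < p i) (q : RealArray r) :
    iDivergence q p = (relEntropy q p : EReal) := by
  have h : arraySupport p = Finset.univ := arraySupport_eq_univ_iff.2 fun i => (hp i).ne'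
  simp only [iDivergence, h, Finset.subset_univ, if_true, relEntropy]

lemma isIProjection_iff {p : RealArray r} (hp : ∀ i, 0 < p i) (F : Set (RealArray r))
    (g : RealArray r) :
    IsIProjection F p g ↔ g ∈ F ∧ ∀ q ∈ F, relEntropy g p ≤ relEntropy q p := by
  unfold IsIProjection
  refine and_congr_right fun hg => ?_
  simp only [iDivergence_eq_relEntropy hp]
  constructor
  · intro h q hq
    exact_mod_cast h.trans_le (iInf₂_le q hq)
  · intro h
    exact le_antisymm (le_iInf₂ fun q hq => by exact_mod_cast h q hq) (iInf₂_le g hg)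

lemma continuous_relEntropy {p : RealArray r} (hp : ∀ i, 0 < p i) :
    Continuous fun q => relEntropy q p := by
  unfold relEntropy
  refine continuous_finsetSum _ fun i _ => ?_
  -- Expressed through `s log s`, which is continuous at `0` although `log` is not.
  have h : (fun q : RealArray r => q i * Real.log (q i / p i)) =
      fun q => p i * (q i / p i * Real.log (q i / p i)) := by
    ext q
    have := (hp i).ne'
    field_simp
  rw [h]
  have hc : Continuous fun q : RealArray r => q i / p i := by fun_prop
  exact continuous_const.mul (Real.continuous_mul_log.comp hc)

lemma isCompact_copulaArrays (hd : 1 ≤ d) (hr : ∀ l, 0 < r l) : IsCompact (copulaArrays r) := by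
  refine IsCompact.of_isClosed_subset (isCompact_Icc (a := (0 : RealArray r)) (b := 1)) ?_ ?_
  · have h : copulaArrays r = {q | (∀ i, 0 ≤ q i) ∧ ∀ l i, margin q l i = 1 / (r l : ℝ)} :=
      Set.ext fun q => mem_copulaArrays_iff hd hr
    rw [h]
    simp only [Set.ofPred_and, Set.ofPred_forall]
    exact (isClosed_iInter fun i => isClosed_le continuous_const (continuous_apply i)).inter
      (isClosed_iInter fun l => isClosed_iInter fun i =>
        isClosed_eq (continuous_margin l i) continuous_const)
  · intro q hq
    exact ⟨fun i => (hq.1.1 i).1, fun i => (hq.1.1 i).2⟩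

lemma exists_isIProjection (hd : 1 ≤ d) (hr : ∀ l, 0 < r l) {p : RealArray r}
    (hp : ∀ i, 0 < p i) : ∃ g, IsIProjection (copulaArrays r) p g := by
  obtain ⟨g, hg, h⟩ := (isCompact_copulaArrays hd hr).exists_isMinOn
    ⟨_, constArray_mem hd hr⟩ (continuous_relEntropy hp).continuousOn
  exact ⟨g, (isIProjection_iff hp _ _).2 ⟨hg, fun q hq => h hq⟩⟩

lemma lineCombination_mem (hd : 1 ≤ d) (hr : ∀ l, 0 < r l) {g u : RealArray r}
    (hg : g ∈ copulaArrays r) (hu : u ∈ copulaArrays r) {t : ℝ} (h0 : 0 ≤ t) (h1 : t ≤ 1) :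
    (1 - t) • g + t • u ∈ copulaArrays r := by
  rw [mem_copulaArrays_iff hd hr] at *
  refine ⟨fun i => ?_, fun l i => ?_⟩
  · have := hg.1 i
    have := hu.1 i
    have : 0 ≤ 1 - t := by linarith
    simp only [Pi.add_apply, Pi.smul_apply, smul_eq_mul]
    positivity
  · rw [margin_add, margin_smul, margin_smul, hg.2, hu.2]
    ring

lemma mul_log_div_convex {p x y t : ℝ} (hp : 0 < p) (hx : 0 ≤ x) (hy : 0 ≤ y) (h0 : 0 ≤ t)
    (h1 : t ≤ 1) :
    ((1 - t) * x + t * y) * Real.log (((1 - t) * x + t * y) / p) ≤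
      (1 - t) * (x * Real.log (x / p)) + t * (y * Real.log (y / p)) := by
  have h := Real.convexOn_mul_log.2 (x := x / p) (y := y / p)
    (by simpa using div_nonneg hx hp.le) (by simpa using div_nonneg hy hp.le)
    (sub_nonneg.2 h1) h0 (by ring)
  simp only [smul_eq_mul] at h
  have e : (1 - t) * (x / p) + t * (y / p) = ((1 - t) * x + t * y) / p := by ring
  rw [e] at h
  have h' := mul_le_mul_of_nonneg_left h hp.le
  have e1 : p * (((1 - t) * x + t * y) / p * Real.log (((1 - t) * x + t * y) / p)) =
      ((1 - t) * x + t * y) * Real.log (((1 - t) * x + t * y) / p) := by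
    field_simp
  have e2 : p * ((1 - t) * (x / p * Real.log (x / p)) + t * (y / p * Real.log (y / p))) =
      (1 - t) * (x * Real.log (x / p)) + t * (y * Real.log (y / p)) := by
    field_simp
  linarith

/-- An `I`-projection on the copula arrays of an array with positive entries has positive
entries. -/
lemma IsIProjection.pos (hd : 1 ≤ d) (hr : ∀ l, 0 < r l) {p g : RealArray r}
    (hp : ∀ i, 0 < p i) (hg : IsIProjection (copulaArrays r) p g) (i : MultiIndex r) :
    0 < g i := by
  rw [isIProjection_iff hp] at hg
  obtain ⟨hg, hmin⟩ := hg
  have hg0 := ((mem_copulaArrays_iff hd hr).1 hg).1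
  refine (hg0 i).lt_of_ne fun hi => ?_
  set u := constArray r
  have hu := constArray_mem hd hr
  have hup := constArray_pos hr
  -- Move from `g` towards `u` by `t`. Convexity bounds every coordinate, and the null coordinate
  -- `i` contributes the extra `t * u i * log t`; dividing by `t`, minimality fails as `t → 0`.
  have key : ∀ t : ℝ, 0 < t → t ≤ 1 →
      0 ≤ relEntropy u p - relEntropy g p + Real.log t * u i := by
    intro t h0 h1
    have h := hmin _ (lineCombination_mem hd hr hg hu h0.le h1)
    have hle : relEntropy ((1 - t) • g + t • u) p ≤
        ∑ j, ((1 - t) * (g j * Real.log (g j / p j)) + t * (u j * Real.log (u j / p j)) +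
          if j = i then t * u i * Real.log t else 0) := by
      refine Finset.sum_le_sum fun j _ => ?_
      simp only [Pi.add_apply, Pi.smul_apply, smul_eq_mul]
      split_ifs with hj
      · subst hj
        rw [← hi]
        have e : ((1 - t) * 0 + t * u j) / p j = t * (u j / p j) := by ring
        rw [e, Real.log_mul h0.ne' (div_pos (hup j) (hp j)).ne']
        apply le_of_eq
        ring
      · rw [add_zero]
        exact mul_log_div_convex (hp j) (hg0 j) (hup j).le h0.le h1
    rw [Finset.sum_add_distrib, Finset.sum_add_distrib, ← Finset.mul_sum, ← Finset.mul_sum,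
      Finset.sum_ite_eq' Finset.univ i, if_pos (Finset.mem_univ i)] at hle
    have h2 : 0 ≤ t * (relEntropy u p - relEntropy g p + Real.log t * u i) := by
      have := h.trans hle
      unfold relEntropy at this ⊢
      linarith
    exact nonneg_of_mul_nonneg_right h2 h0
  have hK : Tendsto (fun t : ℝ => relEntropy u p - relEntropy g p + Real.log t * u i)
      (𝓝[>] 0) atBot :=
    tendsto_atBot_add_const_left _ _ (Real.tendsto_log_nhdsGT_zero.atBot_mul_const (hup i))
  have h1 : ∀ᶠ t : ℝ in 𝓝[>] 0, t ∈ Set.Ioc (0 : ℝ) 1 := Ioc_mem_nhdsGT one_pos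
  obtain ⟨t, ht, h⟩ := ((hK.eventually_lt_atBot 0).and h1).exists
  exact absurd (key t h.1 h.2) (not_le.2 ht)

/-- First-order condition for the minimisation of the relative entropy over the copula arrays. -/
def IsStationary (p g : RealArray r) : Prop :=
  ∀ a ∈ nullMarginArrays (Finset.univ : Finset (MultiIndex r)),
    ∑ i, a i * Real.log (g i / p i) = 0

lemma IsIProjection.isStationary (hd : 1 ≤ d) (hr : ∀ l, 0 < r l) {p g : RealArray r}
    (hp : ∀ i, 0 < p i) (hg : IsIProjection (copulaArrays r) p g) : IsStationary p g := by
  intro a ha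
  have hpos := hg.pos hd hr hp
  rw [isIProjection_iff hp] at hg
  have hderiv : HasDerivAt (fun t : ℝ => relEntropy (g + t • a) p)
      (∑ i, (a i * Real.log (g i / p i) + a i)) 0 := by
    unfold relEntropy
    refine HasDerivAt.fun_sum fun i _ => ?_
    have h1 : HasDerivAt (fun t : ℝ => (g + t • a) i) (a i) 0 := by
      simpa using ((hasDerivAt_id (0 : ℝ)).mul_const (a i)).const_add (g i)
    have h2 : HasDerivAt (fun t : ℝ => Real.log ((g + t • a) i / p i))
        (a i / p i / (g i / p i)) 0 := by
      have := (h1.div_const (p i)).log (by simpa using ⟨(hpos i).ne', (hp i).ne'⟩)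
      simpa using this
    have h3 := h1.mul h2
    have e : a i * Real.log ((g + (0 : ℝ) • a) i / p i) +
        (g + (0 : ℝ) • a) i * (a i / p i / (g i / p i)) =
        a i * Real.log (g i / p i) + a i := by
      have := (hpos i).ne'
      have := (hp i).ne'
      simp
      field_simp
    rw [← e]
    exact h3
  have hlm : IsLocalMin (fun t : ℝ => relEntropy (g + t • a) p) 0 := by
    -- Positivity of `g` allows small `t` of either sign, so `0` is a two-sided local minimum.
    have hev : ∀ᶠ t : ℝ in 𝓝 0, ∀ i, 0 < (g + t • a) i := by
      rw [eventually_all]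
      intro i
      have hc : Continuous fun t : ℝ => (g + t • a) i := by
        simp only [Pi.add_apply, Pi.smul_apply, smul_eq_mul]
        fun_prop
      exact hc.continuousAt.eventually (lt_mem_nhds (by simpa using hpos i))
    filter_upwards [hev] with t ht
    have hmem : g + t • a ∈ copulaArrays r := by
      rw [mem_copulaArrays_iff hd hr]
      refine ⟨fun i => (ht i).le, fun l i => ?_⟩
      rw [margin_add, margin_smul, mem_nullMarginArrays_univ.1 ha, mul_zero, add_zero]
      exact congrFun (hg.1.2 l) i
    simpa using hg.2 _ hmem
  have h0 := hlm.hasDerivAt_eq_zero hderiv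
  rwa [Finset.sum_add_distrib, sum_eq_zero_of_mem_nullMarginArrays hd ha, add_zero] at h0

/-- Termwise Gibbs' inequality: `log s < s - 1` at `s = y / x`. -/
lemma sub_lt_mul_log_div {x y : ℝ} (hx : 0 ≤ x) (hy : 0 < y) (h : x ≠ y) :
    x - y < x * Real.log (x / y) := by
  rcases hx.eq_or_lt with rfl | hx
  · simpa using hy
  · have h1 : y / x ≠ 1 := fun h' => h ((div_eq_one_iff_eq hx.ne').1 h').symm
    have h2 := Real.log_lt_sub_one_of_pos (div_pos hy hx) h1
    have h3 := mul_lt_mul_of_pos_left h2 hx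
    have e : Real.log (x / y) = - Real.log (y / x) := by
      rw [← Real.log_inv, inv_div]
    have e2 : x * (y / x - 1) = y - x := by field_simp
    rw [e]
    linarith

/-- A positive stationary copula array minimises the relative entropy strictly. -/
lemma IsStationary.relEntropy_lt (hd : 1 ≤ d) {p g q : RealArray r}
    (hp : ∀ i, 0 < p i) (hg : g ∈ copulaArrays r) (hgp : ∀ i, 0 < g i) (hst : IsStationary p g)
    (hq : q ∈ copulaArrays r) (hne : q ≠ g) : relEntropy g p < relEntropy q p := by
  have ha := sub_mem_nullMarginArrays hg hq
  have h1 := hst _ ha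
  have h2 := sum_eq_zero_of_mem_nullMarginArrays hd ha
  have hq0 : ∀ i, 0 ≤ q i := fun i => (hq.1.1 i).1
  have h3 : ∑ i, (q - g) i < ∑ i, q i * Real.log (q i / g i) := by
    obtain ⟨i, hi⟩ := Function.ne_iff.1 hne
    refine Finset.sum_lt_sum (fun j _ => ?_)
      ⟨i, Finset.mem_univ i, sub_lt_mul_log_div (hq0 i) (hgp i) hi⟩
    by_cases hj : q j = g j
    · simp [hj, (hgp j).ne']
    · exact (sub_lt_mul_log_div (hq0 j) (hgp j) hj).le
  -- Pythagorean identity; stationarity kills the middle sum.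
  have h4 : relEntropy q p = ∑ i, q i * Real.log (q i / g i) +
      ∑ i, (q - g) i * Real.log (g i / p i) + relEntropy g p := by
    unfold relEntropy
    rw [← Finset.sum_add_distrib, ← Finset.sum_add_distrib]
    refine Finset.sum_congr rfl fun i _ => ?_
    rcases (hq0 i).eq_or_lt with h0 | h0
    · simp [← h0]
    · rw [Real.log_div h0.ne' (hp i).ne', Real.log_div h0.ne' (hgp i).ne',
        Real.log_div (hgp i).ne' (hp i).ne', Pi.sub_apply]
      ring
  linarith

/-- This converse identifies the solution given by the implicit function theorem with the copula
array. -/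
lemma IsStationary.isIProjection (hd : 1 ≤ d) {p g : RealArray r}
    (hp : ∀ i, 0 < p i) (hg : g ∈ copulaArrays r) (hgp : ∀ i, 0 < g i)
    (hst : IsStationary p g) : IsIProjection (copulaArrays r) p g := by
  rw [isIProjection_iff hp]
  refine ⟨hg, fun q hq => ?_⟩
  by_cases h : q = g
  · rw [h]
  · exact (hst.relEntropy_lt hd hp hg hgp hq h).le

lemma existsUnique_isIProjection (hd : 1 ≤ d) (hr : ∀ l, 0 < r l) {p : RealArray r}
    (hp : ∀ i, 0 < p i) : ∃! g, IsIProjection (copulaArrays r) p g := by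
  obtain ⟨g, hg⟩ := exists_isIProjection hd hr hp
  refine ⟨g, hg, fun q hq => ?_⟩
  by_contra hne
  have hlt := (hg.isStationary hd hr hp).relEntropy_lt hd hp hg.1 (hg.pos hd hr hp) hq.1 hne
  exact absurd (((isIProjection_iff hp _ _).1 hq).2 g hg.1) (not_le.2 hlt)

lemma isIProjection_copulaArray (hd : 1 ≤ d) (hr : ∀ l, 0 < r l) {p : RealArray r}
    (hp : ∀ i, 0 < p i) : IsIProjection (copulaArrays r) p (copulaArray p) :=
  Classical.epsilon_spec (exists_isIProjection hd hr hp)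

end

section

/-! ### Weighted Gram matrices and the sandwich covariance -/

section Gram

variable {m k : ℕ}

lemma inv_diagonal_of_ne_zero {v : Fin m → ℝ} (hv : ∀ j, v j ≠ 0) :
    (Matrix.diagonal v)⁻¹ = Matrix.diagonal fun j => (v j)⁻¹ := by
  refine Matrix.inv_eq_right_inv ?_
  rw [Matrix.diagonal_mul_diagonal, ← Matrix.diagonal_one]
  congr 1
  ext j
  exact mul_inv_cancel₀ (hv j)

lemma weightedGram_eq (A : Matrix (Fin m) (Fin k) ℝ) {v : EuclideanSpace ℝ (Fin m)}
    (hv : ∀ j, 0 < v j) :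
    weightedGram A v = Aᵀ * (Matrix.diagonal fun j => (v j)⁻¹) * A := by
  rw [weightedGram, inv_diagonal_of_ne_zero fun j => (hv j).ne']

lemma weightedGram_posSemidef (A : Matrix (Fin m) (Fin k) ℝ) {v : EuclideanSpace ℝ (Fin m)}
    (hv : ∀ j, 0 < v j) : (weightedGram A v).PosSemidef := by
  rw [weightedGram_eq A hv]
  exact (Matrix.PosSemidef.diagonal fun j => (inv_pos.2 (hv j)).le).conjTranspose_mul_mul_same A

lemma weightedGram_posDef {A : Matrix (Fin m) (Fin k) ℝ} (hA : Function.Injective A.mulVec)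
    {v : EuclideanSpace ℝ (Fin m)} (hv : ∀ j, 0 < v j) : (weightedGram A v).PosDef := by
  rw [weightedGram_eq A hv]
  exact (Matrix.PosDef.diagonal fun j => inv_pos.2 (hv j)).conjTranspose_mul_mul_same hA

lemma weightedGram_transpose (A : Matrix (Fin m) (Fin k) ℝ) {v : EuclideanSpace ℝ (Fin m)}
    (hv : ∀ j, 0 < v j) : (weightedGram A v)ᵀ = weightedGram A v :=
  (weightedGram_posSemidef A hv).isHermitian

lemma sandwichCov_posSemidef (A : Matrix (Fin m) (Fin k) ℝ) {g p : EuclideanSpace ℝ (Fin m)}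
    (hg : ∀ j, 0 < g j) (hp : ∀ j, 0 < p j) : (sandwichCov A g p).PosSemidef := by
  have h := (weightedGram_posSemidef A hp).mul_mul_conjTranspose_same
    (A * (weightedGram A g)⁻¹)
  have e : (A * (weightedGram A g)⁻¹).conjTranspose = (weightedGram A g)⁻¹ * Aᵀ := by
    rw [Matrix.conjTranspose_eq_transpose_of_trivial, Matrix.transpose_mul,
      Matrix.transpose_nonsing_inv, weightedGram_transpose A hg]
  rw [e] at h
  simpa only [sandwichCov, Matrix.mul_assoc] using h

/-- The Jacobian matrix `A [Aᵀ diag⁻¹(g) A]⁻¹ Aᵀ diag⁻¹(p)` of the copula array. -/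
def projectionJacobian (A : Matrix (Fin m) (Fin k) ℝ) (g p : EuclideanSpace ℝ (Fin m)) :
    Matrix (Fin m) (Fin m) ℝ :=
  A * ((weightedGram A g)⁻¹ * Aᵀ * Matrix.diagonal fun j => (p j)⁻¹)

/-- Since `diag⁻¹(p) p = 1` and `Aᵀ 1 = 0`, the rank-one part vanishes and `Aᵀ diag⁻¹(p) (diag p - p
pᵀ) = Aᵀ`. -/
lemma projectionJacobian_mul_multinomialCov_mul (A : Matrix (Fin m) (Fin k) ℝ)
    {g p : EuclideanSpace ℝ (Fin m)} (hg : ∀ j, 0 < g j) (hp : ∀ j, 0 < p j)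
    (hA : Aᵀ *ᵥ (fun _ => (1 : ℝ)) = 0) :
    projectionJacobian A g p * multinomialCov p * (projectionJacobian A g p)ᵀ =
      sandwichCov A g p := by
  have h1 : (Matrix.diagonal fun j => (p j)⁻¹) * (Matrix.diagonal fun j => p j) = 1 := by
    rw [Matrix.diagonal_mul_diagonal, ← Matrix.diagonal_one]
    congr 1
    ext j
    exact inv_mul_cancel₀ (hp j).ne'
  have h2 : Aᵀ * (Matrix.diagonal fun j => (p j)⁻¹) *
      Matrix.vecMulVec (fun j => p j) (fun j => p j) = 0 := by
    rw [Matrix.mul_assoc, Matrix.mul_vecMulVec, Matrix.mul_vecMulVec]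
    have : (Matrix.diagonal fun j => (p j)⁻¹) *ᵥ (fun j => p j) = fun _ => (1 : ℝ) := by
      ext j
      rw [Matrix.mulVec_diagonal]
      exact inv_mul_cancel₀ (hp j).ne'
    rw [this, hA, Matrix.zero_vecMulVec]
  have h3 : Aᵀ * (Matrix.diagonal fun j => (p j)⁻¹) * multinomialCov p = Aᵀ := by
    rw [multinomialCov, Matrix.mul_sub, h2, sub_zero, Matrix.mul_assoc, h1, Matrix.mul_one]
  have h4 : projectionJacobian A g p * multinomialCov p = A * (weightedGram A g)⁻¹ * Aᵀ := by
    rw [projectionJacobian, Matrix.mul_assoc, Matrix.mul_assoc, Matrix.mul_assoc,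
      ← Matrix.mul_assoc Aᵀ, h3, Matrix.mul_assoc]
  have h5 : (projectionJacobian A g p)ᵀ =
      (Matrix.diagonal fun j => (p j)⁻¹) * A * (weightedGram A g)⁻¹ * Aᵀ := by
    simp only [projectionJacobian, Matrix.transpose_mul, Matrix.transpose_transpose,
      Matrix.diagonal_transpose, Matrix.transpose_nonsing_inv, weightedGram_transpose A hg,
      Matrix.mul_assoc]
  rw [h4, h5, sandwichCov, weightedGram_eq A hp]
  simp only [Matrix.mul_assoc]

end Gram

/-! ### Implicit function theorem for the stationarity equation -/

section Implicit

variable {m k : ℕ}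

/-- The map `(p, θ) ↦ Aᵀ (log (u + A θ) - log p)`. -/
def scoreMap (A : Matrix (Fin m) (Fin k) ℝ) (u : Fin m → ℝ)
    (z : (Fin m → ℝ) × (Fin k → ℝ)) : Fin k → ℝ :=
  Aᵀ *ᵥ fun j => Real.log ((u + A *ᵥ z.2) j) - Real.log (z.1 j)

/-- The derivative of `scoreMap`. -/
def scoreDeriv (A : Matrix (Fin m) (Fin k) ℝ) (g p : Fin m → ℝ) :
    (Fin m → ℝ) × (Fin k → ℝ) →L[ℝ] Fin k → ℝ :=
  LinearMap.toContinuousLinearMap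
    { toFun := fun z => Aᵀ *ᵥ fun j => (g j)⁻¹ * (A *ᵥ z.2) j - (p j)⁻¹ * z.1 j
      map_add' := by
        intro x y
        rw [← Matrix.mulVec_add]
        congr 1
        ext j
        simp only [Prod.fst_add, Prod.snd_add, Matrix.mulVec_add, Pi.add_apply]
        ring
      map_smul' := by
        intro c x
        rw [RingHom.id_apply, ← Matrix.mulVec_smul]
        congr 1
        ext j
        simp only [Prod.smul_fst, Prod.smul_snd, Matrix.mulVec_smul, Pi.smul_apply, smul_eq_mul]
        ring }

lemma scoreDeriv_apply (A : Matrix (Fin m) (Fin k) ℝ) (g p : Fin m → ℝ)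
    (z : (Fin m → ℝ) × (Fin k → ℝ)) :
    scoreDeriv A g p z = Aᵀ *ᵥ fun j => (g j)⁻¹ * (A *ᵥ z.2) j - (p j)⁻¹ * z.1 j := rfl

lemma hasStrictFDerivAt_scoreMap (A : Matrix (Fin m) (Fin k) ℝ) (u p : Fin m → ℝ)
    (θ : Fin k → ℝ) (hp : ∀ j, 0 < p j) (hg : ∀ j, 0 < (u + A *ᵥ θ) j) :
    HasStrictFDerivAt (scoreMap A u) (scoreDeriv A (u + A *ᵥ θ) p) (p, θ) := by
  let T : (Fin m → ℝ) →L[ℝ] Fin k → ℝ := LinearMap.toContinuousLinearMap Aᵀ.mulVecLin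
  let S : (Fin k → ℝ) →L[ℝ] Fin m → ℝ := LinearMap.toContinuousLinearMap A.mulVecLin
  let pr : Fin m → (Fin m → ℝ) →L[ℝ] ℝ := fun j => ContinuousLinearMap.proj j
  have h1 : HasStrictFDerivAt (fun (z : (Fin m → ℝ) × (Fin k → ℝ)) (j : Fin m) =>
      Real.log ((u + A *ᵥ z.2) j) - Real.log (z.1 j))
      (ContinuousLinearMap.pi fun j => ((u + A *ᵥ θ) j)⁻¹ •
          ((pr j).comp (S.comp (ContinuousLinearMap.snd ℝ _ _))) -
        (p j)⁻¹ • ((pr j).comp (ContinuousLinearMap.fst ℝ _ _))) (p, θ) := by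
    rw [hasStrictFDerivAt_pi]
    intro j
    have ha : HasStrictFDerivAt (fun z : (Fin m → ℝ) × (Fin k → ℝ) => (u + A *ᵥ z.2) j)
        ((pr j).comp (S.comp (ContinuousLinearMap.snd ℝ _ _))) (p, θ) :=
      ((pr j).comp
        (S.comp (ContinuousLinearMap.snd ℝ (Fin m → ℝ) (Fin k → ℝ)))).hasStrictFDerivAt.const_add
        (u j)
    have hb : HasStrictFDerivAt (fun z : (Fin m → ℝ) × (Fin k → ℝ) => z.1 j)
        ((pr j).comp (ContinuousLinearMap.fst ℝ _ _)) (p, θ) :=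
      ((pr j).comp (ContinuousLinearMap.fst ℝ (Fin m → ℝ) (Fin k → ℝ))).hasStrictFDerivAt
    exact (ha.log (hg j).ne').sub (hb.log (hp j).ne')
  have h2 := (T.hasStrictFDerivAt (x := fun j => Real.log ((u + A *ᵥ θ) j) - Real.log (p j))).comp
    (p, θ) h1
  exact h2.congr_fderiv (ContinuousLinearMap.ext fun _ => rfl)

/-- Solutions `θ` of `Aᵀ (log (u + A θ) - log p) = 0` depend differentiably on `p`. -/
theorem exists_hasFDerivAt_score_solution (A : Matrix (Fin m) (Fin k) ℝ)
    (hA : Function.Injective A.mulVec) (u : Fin m → ℝ) (p : EuclideanSpace ℝ (Fin m))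
    (θ₀ : Fin k → ℝ) (hp : ∀ j, 0 < p j) (hg : ∀ j, 0 < (u + A *ᵥ θ₀) j)
    (h0 : scoreMap A u (⇑p, θ₀) = 0) :
    ∃ θ : (Fin m → ℝ) → Fin k → ℝ,
      HasFDerivAt θ (LinearMap.toContinuousLinearMap
        ((weightedGram A (WithLp.toLp 2 (u + A *ᵥ θ₀)))⁻¹ * Aᵀ *
          Matrix.diagonal fun j => (p j)⁻¹).mulVecLin) p ∧
      θ p = θ₀ ∧ ∀ᶠ p' in 𝓝 (⇑p : Fin m → ℝ), scoreMap A u (p', θ p') = 0 := by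
  set g : EuclideanSpace ℝ (Fin m) := WithLp.toLp 2 (u + A *ᵥ θ₀)
  have hs := hasStrictFDerivAt_scoreMap A u p θ₀ hp hg
  have hG : IsUnit (weightedGram A g) := (weightedGram_posDef hA (v := g) hg).isUnit
  -- The partial derivative in `θ` is the Gram matrix, hence invertible.
  have hinr : ∀ y : Fin k → ℝ, (scoreDeriv A (u + A *ᵥ θ₀) p ∘L .inr ℝ _ _) y =
      weightedGram A g *ᵥ y := by
    intro y
    rw [weightedGram_eq A (v := g) hg, ContinuousLinearMap.comp_apply, scoreDeriv_apply,
      ← Matrix.mulVec_mulVec, ← Matrix.mulVec_mulVec]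
    congr 1
    ext j
    rw [Matrix.mulVec_diagonal]
    simp [g]
  have hinv : (scoreDeriv A (u + A *ᵥ θ₀) p ∘L .inr ℝ _ _).IsInvertible := by
    let e : (Fin k → ℝ) ≃ₗ[ℝ] (Fin k → ℝ) :=
      LinearEquiv.ofBijective (weightedGram A g).mulVecLin
        ⟨Matrix.mulVec_injective_iff_isUnit.2 hG, Matrix.mulVec_surjective_iff_isUnit.2 hG⟩
    refine ⟨e.toContinuousLinearEquiv, ?_⟩
    ext1 y
    exact (hinr y).symm
  refine ⟨hs.implicitFunctionOfProdDomain hinv, ?_, ?_, ?_⟩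
  · have h := (hs.hasStrictFDerivAt_implicitFunctionOfProdDomain hinv).hasFDerivAt
    refine h.congr_fderiv ?_
    symm
    ext1 y
    -- The implicit derivative is `-(∂θ)⁻¹ ∂p`; applying the injective `∂θ` to both candidates
    -- avoids computing the inverse.
    apply hinv.injective
    have hi := hinv.self_apply_inverse (scoreDeriv A (u + A *ᵥ θ₀) p (y, 0))
    rw [hinr, neg_apply, map_neg]
    refine Eq.trans ?_ (congrArg Neg.neg hi).symm
    rw [scoreDeriv_apply]
    change weightedGram A g *ᵥ (((weightedGram A g)⁻¹ * Aᵀ *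
          Matrix.diagonal fun j => (p j)⁻¹) *ᵥ y) = _
    rw [Matrix.mulVec_mulVec, Matrix.mul_assoc, ← Matrix.mul_assoc, Matrix.mul_nonsing_inv _
      ((Matrix.isUnit_iff_isUnit_det _).1 hG), Matrix.one_mul, ← Matrix.mulVec_mulVec,
      ← Matrix.mulVec_neg]
    congr 1
    ext j
    rw [Matrix.mulVec_diagonal]
    simp
  · exact (hs.eventually_apply_eq_iff_implicitFunctionOfProdDomain hinv).self_of_nhds.1 rfl
  · filter_upwards [hs.eventually_apply_implicitFunctionOfProdDomain hinv] with x hx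
    rw [hx, h0]

end Implicit

/-! ### Coordinates on null-margin arrays and differentiability of the copula array -/

variable {d : ℕ} {r : Fin d → ℕ}

/-- The array with column-major vectorisation `y`. -/
def unvec (r : Fin d → ℕ) (y : Fin (∏ l, r l) → ℝ) : RealArray r := fun i => y (finPiFinEquiv i)

@[simp] lemma unvec_vec (a : RealArray r) : unvec r (vec a) = a := by
  ext i
  simp [unvec, vec]

@[simp] lemma vec_apply (a : RealArray r) (j : Fin (∏ l, r l)) :
    vec a j = a (finPiFinEquiv.symm j) := rfl

lemma sum_vec_mul (a c : RealArray r) :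
    ∑ j, a (finPiFinEquiv.symm j) * c (finPiFinEquiv.symm j) = ∑ i, a i * c i :=
  Equiv.sum_comp finPiFinEquiv.symm fun i => a i * c i

section Basis

variable {k : ℕ}
  (b : Module.Basis (Fin k) ℝ (nullMarginArrays (Finset.univ : Finset (MultiIndex r))))

lemma basisMatrix_mulVec (θ : Fin k → ℝ) (j : Fin (∏ l, r l)) :
    (basisMatrix b *ᵥ θ) j = (∑ c, θ c • b c : nullMarginArrays _).1 (finPiFinEquiv.symm j) := by
  simp [Matrix.mulVec, dotProduct, basisMatrix, mul_comm]

lemma basisMatrix_mulVec_injective : Function.Injective (basisMatrix b).mulVec := by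
  intro θ η h
  have h1 : (∑ c, θ c • b c : nullMarginArrays _) = ∑ c, η c • b c := by
    refine Subtype.ext (funext fun i => ?_)
    have := congrFun h (finPiFinEquiv i)
    rw [basisMatrix_mulVec, basisMatrix_mulVec] at this
    simpa using this
  have h2 := congrArg b.equivFun h1
  rw [← b.equivFun_symm_apply, ← b.equivFun_symm_apply] at h2
  simpa only [LinearEquiv.apply_symm_apply] using h2

lemma basisMatrix_transpose_mulVec (c : RealArray r) (i : Fin k) :
    ((basisMatrix b)ᵀ *ᵥ fun j => c (finPiFinEquiv.symm j)) i = ∑ t, (b i).1 t * c t := by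
  rw [← sum_vec_mul]
  simp [Matrix.mulVec, dotProduct, basisMatrix]

lemma basisMatrix_transpose_mulVec_one (hd : 1 ≤ d) :
    (basisMatrix b)ᵀ *ᵥ (fun _ => (1 : ℝ)) = 0 := by
  ext i
  have h := basisMatrix_transpose_mulVec b (fun _ => 1) i
  rw [h]
  simpa using sum_eq_zero_of_mem_nullMarginArrays hd (b i).2

lemma exists_basisMatrix_mulVec_eq {a : RealArray r}
    (ha : a ∈ nullMarginArrays (Finset.univ : Finset (MultiIndex r))) :
    ∃ θ, ∀ j, (basisMatrix b *ᵥ θ) j = a (finPiFinEquiv.symm j) := by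
  refine ⟨b.equivFun ⟨a, ha⟩, fun j => ?_⟩
  rw [basisMatrix_mulVec, b.sum_equivFun]

/-- The columns of the basis matrix span the null-margin arrays, so orthogonality need only be
tested on them. -/
lemma isStationary_iff {p g : RealArray r} :
    IsStationary p g ↔
      (basisMatrix b)ᵀ *ᵥ (fun j => Real.log (g (finPiFinEquiv.symm j) /
        p (finPiFinEquiv.symm j))) = 0 := by
  constructor
  · intro h
    ext i
    rw [basisMatrix_transpose_mulVec b (fun i => Real.log (g i / p i))]
    exact h _ (b i).2
  · intro h a ha
    obtain ⟨θ, hθ⟩ := exists_basisMatrix_mulVec_eq b ha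
    rw [← sum_vec_mul a fun i => Real.log (g i / p i)]
    simp only [← hθ]
    change (basisMatrix b *ᵥ θ) ⬝ᵥ (fun j => Real.log (g (finPiFinEquiv.symm j) /
        p (finPiFinEquiv.symm j))) = 0
    rw [dotProduct_comm, Matrix.dotProduct_mulVec, ← Matrix.mulVec_transpose, h, zero_dotProduct]

/-- The copula array is a differentiable function of the probability array. -/
theorem hasFDerivAt_vec_copulaArray (hd : 1 ≤ d) (hr : ∀ l, 0 < r l) {p : RealArray r}
    (hp : ∀ i, 0 < p i) :
    HasFDerivAt (fun y : EuclideanSpace ℝ (Fin (∏ l, r l)) => vec (copulaArray (unvec r y)))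
      (Matrix.toEuclideanCLM (𝕜 := ℝ)
        (projectionJacobian (basisMatrix b) (vec (copulaArray p)) (vec p))) (vec p) := by
  set A := basisMatrix b
  have hproj := isIProjection_copulaArray hd hr hp
  have hgpos := hproj.pos hd hr hp
  set g := copulaArray p
  -- Affine coordinates on the uniform-margin arrays, with the constant array as origin.
  obtain ⟨θ₀, hθ₀⟩ := exists_basisMatrix_mulVec_eq b
    (sub_mem_nullMarginArrays (constArray_mem hd hr) hproj.1)
  let u : Fin (∏ l, r l) → ℝ := fun j => constArray r (finPiFinEquiv.symm j)
  have hug : ∀ j, (u + A *ᵥ θ₀) j = vec g j := by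
    intro j
    simp [u, A, hθ₀]
  have hug' : WithLp.toLp 2 (u + A *ᵥ θ₀) = vec g := by
    ext j
    exact hug j
  have hscore : ∀ (p' : RealArray r) (θ : Fin _ → ℝ), (∀ i, 0 < p' i) →
      (∀ j, 0 < (u + A *ᵥ θ) j) →
      (scoreMap A u ((fun j => p' (finPiFinEquiv.symm j)), θ) = 0 ↔
        IsStationary p' (unvec r (u + A *ᵥ θ))) := by
    intro p' θ hp' hθ
    rw [isStationary_iff b, scoreMap]
    have e : (fun j => Real.log (unvec r (u + A *ᵥ θ) (finPiFinEquiv.symm j) /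
        p' (finPiFinEquiv.symm j))) = fun j => Real.log ((u + A *ᵥ θ) j) -
        Real.log (p' (finPiFinEquiv.symm j)) := by
      ext j
      rw [Real.log_div]
      · simp [unvec]
      · simpa [unvec] using (hθ j).ne'
      · exact (hp' _).ne'
    rw [e]
  have hpos₀ : ∀ j, 0 < (u + A *ᵥ θ₀) j := fun j => by
    rw [hug]
    exact hgpos _
  have h0 : scoreMap A u (⇑(vec p), θ₀) = 0 := by
    refine (hscore p θ₀ hp hpos₀).2 ?_
    have : unvec r (u + A *ᵥ θ₀) = g := by
      ext i
      simp [unvec, hug]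
    rw [this]
    exact hproj.isStationary hd hr hp
  obtain ⟨θ, hθd, hθp, hθ⟩ := exists_hasFDerivAt_score_solution A
    (basisMatrix_mulVec_injective b) u (vec p) θ₀ (fun j => hp _) hpos₀ h0
  let E := EuclideanSpace.equiv (Fin (∏ l, r l)) ℝ
  let S : (Fin k → ℝ) →L[ℝ] EuclideanSpace ℝ (Fin (∏ l, r l)) :=
    E.symm.toContinuousLinearMap.comp (LinearMap.toContinuousLinearMap A.mulVecLin)
  have hcont : ContinuousAt (fun y : Fin (∏ l, r l) → ℝ => u + A *ᵥ θ y) (⇑(vec p)) := by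
    have : Continuous fun t : Fin k → ℝ => u + A *ᵥ t := by fun_prop
    exact this.continuousAt.comp hθd.continuousAt
  have hev1 : ∀ᶠ y in 𝓝 (⇑(vec p) : Fin (∏ l, r l) → ℝ), ∀ j, 0 < (u + A *ᵥ θ y) j := by
    rw [eventually_all]
    intro j
    refine ((continuous_apply j).continuousAt.comp hcont).eventually (lt_mem_nhds ?_)
    simpa only [Function.comp, hθp] using hpos₀ j
  have hev2 : ∀ᶠ y in 𝓝 (⇑(vec p) : Fin (∏ l, r l) → ℝ), ∀ j, 0 < y j := by
    rw [eventually_all]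
    exact fun j => (continuous_apply j).continuousAt.eventually (lt_mem_nhds (hp _))
  -- Near `p` the implicit solution is positive, has uniform margins and is stationary; uniqueness
  -- of the projection identifies it.
  have hev : ∀ᶠ y in 𝓝 (⇑(vec p) : Fin (∏ l, r l) → ℝ),
      vec (copulaArray (unvec r y)) = WithLp.toLp 2 (u + A *ᵥ θ y) := by
    filter_upwards [hθ, hev1, hev2] with y h1 h2 h3
    have hy : ∀ i, 0 < unvec r y i := fun i => h3 _
    have hst : IsStationary (unvec r y) (unvec r (u + A *ᵥ θ y)) := by
      refine (hscore (unvec r y) (θ y) hy h2).1 ?_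
      simpa [unvec] using h1
    have hmem : unvec r (u + A *ᵥ θ y) ∈ copulaArrays r := by
      have e : unvec r (u + A *ᵥ θ y) = constArray r + (∑ c, θ y c • b c :
          nullMarginArrays _).1 := by
        ext i
        simp only [unvec, Pi.add_apply, A, basisMatrix_mulVec, u, Equiv.symm_apply_apply]
      rw [e, mem_copulaArrays_iff hd hr]
      refine ⟨fun i => ?_, fun l i => ?_⟩
      · rw [← e]
        exact (h2 _).le
      · rw [margin_add, mem_nullMarginArrays_univ.1 (∑ c, θ y c • b c : nullMarginArrays _).2,
          add_zero]
        exact ((mem_copulaArrays_iff hd hr).1 (constArray_mem hd hr)).2 l i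
    have heq := (existsUnique_isIProjection hd hr hy).unique
      (isIProjection_copulaArray hd hr hy) (hst.isIProjection hd hy hmem fun i => h2 _)
    rw [heq]
    ext j
    simp [unvec]
  have hE : HasFDerivAt (fun y : EuclideanSpace ℝ (Fin (∏ l, r l)) => θ y)
      ((LinearMap.toContinuousLinearMap ((weightedGram A (vec g))⁻¹ * Aᵀ *
          Matrix.diagonal fun j => (vec p j)⁻¹).mulVecLin).comp E.toContinuousLinearMap)
      (vec p) := by
    rw [hug'] at hθd
    exact HasFDerivAt.comp (vec p) hθd E.hasFDerivAt
  have hS := ((S.hasFDerivAt (x := θ (vec p))).comp (vec p) hE).const_add (WithLp.toLp 2 u)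
  have hev' : ∀ᶠ y : EuclideanSpace ℝ (Fin (∏ l, r l)) in 𝓝 (vec p),
      vec (copulaArray (unvec r y)) = WithLp.toLp 2 (u + A *ᵥ θ y) :=
    (E.continuous.tendsto (vec p)).eventually hev
  refine (hS.congr_of_eventuallyEq hev').congr_fderiv (ContinuousLinearMap.ext fun y => ?_)
  refine PiLp.ext fun j => ?_
  change (A *ᵥ (((weightedGram A (vec g))⁻¹ * Aᵀ *
    Matrix.diagonal fun j => (vec p j)⁻¹) *ᵥ ⇑y)) j = (projectionJacobian A (vec g) (vec p) *ᵥ ⇑y) j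
  rw [Matrix.mulVec_mulVec, projectionJacobian]

end Basis

end

section

/-! ### Delta method -/

section DeltaMethod

variable {Ω Ω' E F : Type*} {mΩ : MeasurableSpace Ω} {mΩ' : MeasurableSpace Ω'}
  {μ : Measure Ω} [IsProbabilityMeasure μ] {μ' : Measure Ω'} [IsProbabilityMeasure μ']
  [NormedAddCommGroup E] [NormedSpace ℝ E] [FiniteDimensional ℝ E] [MeasurableSpace E]
  [BorelSpace E]
  [NormedAddCommGroup F] [NormedSpace ℝ F] [FiniteDimensional ℝ F] [MeasurableSpace F]
  [BorelSpace F]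

/-- A sequence that converges in distribution is bounded in probability. -/
lemma exists_eventually_measure_norm_lt {Y : ℕ → Ω → E} {Z : Ω' → E}
    (h : TendstoInDistribution Y atTop Z (fun _ => μ) μ') {δ : ENNReal} (hδ : 0 < δ) :
    ∃ K : ℝ, 0 < K ∧ ∀ᶠ n in atTop, μ {ω | K ≤ ‖Y n ω‖} < δ := by
  have : ProperSpace E := FiniteDimensional.proper ℝ E
  have : IsProbabilityMeasure (μ'.map Z) :=
    Measure.isProbabilityMeasure_map h.aemeasurable_limit
  have ht := tendsto_measure_norm_gt_of_isTightMeasureSet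
    (isTightMeasureSet_singleton (μ := μ'.map Z))
  simp only [Set.mem_singleton_iff, iSup_iSup_eq_left] at ht
  obtain ⟨R, hR, hR0⟩ := ((ht.eventually_lt_const hδ).and (eventually_gt_atTop 0)).exists
  -- Tightness controls `R < ‖x‖`, while the portmanteau bound needs a closed set; `R + 1 ≤ ‖x‖` is
  -- closed and contained in it.
  refine ⟨R + 1, by linarith, ?_⟩
  have hcl : IsClosed {x : E | R + 1 ≤ ‖x‖} := isClosed_le continuous_const continuous_norm
  have hlim := ProbabilityMeasure.limsup_measure_closed_le_of_tendsto h.tendsto hcl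
  have hlt : limsup (fun n => (μ.map (Y n)) {x : E | R + 1 ≤ ‖x‖}) atTop < δ := by
    refine lt_of_le_of_lt (hlim.trans (measure_mono ?_)) hR
    intro x (hx : R + 1 ≤ ‖x‖)
    change R < ‖x‖
    linarith
  filter_upwards [eventually_lt_of_limsup_lt hlt] with n hn
  rwa [Measure.map_apply_of_aemeasurable (h.forall_aemeasurable n) hcl.measurableSet] at hn

/-- The delta method. -/
theorem tendstoInDistribution_delta {V : ℕ → Ω → E} {v : E} {Z : Ω' → E} {f : E → F}
    {f' : E →L[ℝ] F}
    (h : TendstoInDistribution (fun (n : ℕ) ω => Real.sqrt n • (V n ω - v)) atTop Z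
      (fun _ => μ) μ')
    (hf : HasFDerivAt f f' v)
    (hm : ∀ n : ℕ, AEMeasurable (fun ω => Real.sqrt n • (f (V n ω) - f v)) μ) :
    TendstoInDistribution (fun (n : ℕ) ω => Real.sqrt n • (f (V n ω) - f v)) atTop (f' ∘ Z)
      (fun _ => μ) μ' := by
  refine tendstoInDistribution_of_tendstoInMeasure_sub _ _ (h.continuous_comp f'.continuous)
    ?_ hm
  rw [tendstoInMeasure_iff_norm]
  intro ε hε
  refine ENNReal.tendsto_nhds_zero.2 fun δ hδ => ?_
  obtain ⟨K, hK, hev⟩ := exists_eventually_measure_norm_lt h hδ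
  have hlo := hf.isLittleO.def (c := ε / (2 * K)) (by positivity)
  rw [Metric.eventually_nhds_iff] at hlo
  obtain ⟨ρ, hρ, hlo⟩ := hlo
  have hsq : ∀ᶠ n : ℕ in atTop, K / ρ < Real.sqrt n :=
    (Real.tendsto_sqrt_atTop.comp tendsto_natCast_atTop_atTop).eventually_gt_atTop _
  filter_upwards [hev, hsq] with n hn hn2
  refine (measure_mono fun ω hω => ?_).trans hn.le
  by_contra hlt
  simp only [Set.mem_ofPred_eq, not_le, norm_smul, Real.norm_eq_abs,
    abs_of_nonneg (Real.sqrt_nonneg (n : ℝ))] at hlt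
  have hs : 0 < Real.sqrt n := lt_of_le_of_lt (by positivity) hn2
  have hd : dist (V n ω) v < ρ := by
    rw [dist_eq_norm]
    rw [div_lt_iff₀ hρ] at hn2
    by_contra hge
    have := mul_le_mul_of_nonneg_left (not_lt.1 hge) hs.le
    linarith
  have hb := hlo hd
  have he : ε ≤ Real.sqrt n * ‖f (V n ω) - f v - f' (V n ω - v)‖ := by
    have hω' : ε ≤ ‖Real.sqrt n • (f (V n ω) - f v) - f' (Real.sqrt n • (V n ω - v)) - 0‖ := hω
    rwa [map_smul, ← smul_sub, sub_zero, norm_smul, Real.norm_eq_abs, abs_of_pos hs] at hω'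
  have h1 := mul_le_mul_of_nonneg_left hb hs.le
  have h2 : Real.sqrt n * (ε / (2 * K) * ‖V n ω - v‖) ≤ ε / 2 := by
    have h3 := mul_le_mul_of_nonneg_left hlt.le (show 0 ≤ ε / (2 * K) by positivity)
    have h4 : ε / (2 * K) * K = ε / 2 := by field_simp
    linarith
  linarith

end DeltaMethod

/-! ### Linear images of Gaussian laws and the multivariate central limit theorem -/

section Gaussian

variable {m : ℕ}

lemma map_toEuclideanCLM_multivariateGaussian {C : Matrix (Fin m) (Fin m) ℝ}
    (hC : C.PosSemidef) (M : Matrix (Fin m) (Fin m) ℝ) :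
    (multivariateGaussian 0 C).map (Matrix.toEuclideanCLM (𝕜 := ℝ) M) =
      multivariateGaussian 0 (M * C * Mᵀ) := by
  have hC' : (M * C * Mᵀ).PosSemidef := hC.mul_mul_conjTranspose_same M
  have : IsProbabilityMeasure
      ((multivariateGaussian 0 C).map (Matrix.toEuclideanCLM (𝕜 := ℝ) M)) :=
    Measure.isProbabilityMeasure_map (by fun_prop)
  refine Measure.ext_of_charFun (funext fun t => ?_)
  have h1 : charFun ((multivariateGaussian 0 C).map (Matrix.toEuclideanCLM (𝕜 := ℝ) M)) t =
      charFun (multivariateGaussian 0 C) (Matrix.toEuclideanCLM (𝕜 := ℝ) Mᵀ t) := by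
    rw [charFun_apply, charFun_apply, integral_map (by fun_prop) (by fun_prop)]
    congr 1
    ext y
    congr 3
    rw [real_inner_comm, Matrix.inner_toEuclideanCLM, Matrix.inner_toEuclideanCLM,
      Matrix.dotProduct_mulVec,
      ← Matrix.mulVec_transpose, dotProduct_comm]
  rw [h1, charFun_multivariateGaussian hC, charFun_multivariateGaussian hC',
    Matrix.ofLp_toEuclideanCLM, inner_zero_right, inner_zero_right]
  congr 4
  rw [← Matrix.mulVec_mulVec, ← Matrix.mulVec_mulVec, Matrix.dotProduct_mulVec t.ofLp M,
    ← Matrix.mulVec_transpose]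

variable {Ω : Type*} {mΩ : MeasurableSpace Ω} {μ : Measure Ω} [IsProbabilityMeasure μ]

/-- Multivariate central limit theorem. -/
theorem tendstoInDistribution_multivariate_clt {W : ℕ → Ω → EuclideanSpace ℝ (Fin m)}
    {w : EuclideanSpace ℝ (Fin m)} {C : Matrix (Fin m) (Fin m) ℝ} (hC : C.PosSemidef)
    (hindep : iIndepFun W μ) (hident : ∀ i, IdentDistrib (W i) (W 0) μ μ)
    (hL2 : MemLp (W 0) 2 μ) (hmean : ∀ t, ∫ ω, inner ℝ t (W 0 ω) ∂μ = inner ℝ t w)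
    (hvar : ∀ t : EuclideanSpace ℝ (Fin m),
      Var[fun ω => inner ℝ t (W 0 ω); μ] = t ⬝ᵥ C *ᵥ t) :
    TendstoInDistribution
      (fun (n : ℕ) ω => (Real.sqrt n)⁻¹ • (∑ k ∈ Finset.range n, W k ω - (n : ℝ) • w)) atTop
      (id : EuclideanSpace ℝ (Fin m) → _) (fun _ => μ) (multivariateGaussian 0 C) where
  forall_aemeasurable n := by
    have hW : ∀ k, AEMeasurable (W k) μ := fun k => (hident k).aemeasurable_fst
    fun_prop
  tendsto := by
    have hW : ∀ k, AEMeasurable (W k) μ := fun k => (hident k).aemeasurable_fst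
    have hS : ∀ n : ℕ, AEMeasurable
        (fun ω => (Real.sqrt n)⁻¹ • (∑ k ∈ Finset.range n, W k ω - (n : ℝ) • w)) μ := fun n => by
      fun_prop
    refine ProbabilityMeasure.tendsto_iff_tendsto_charFun.2 fun t => ?_
    have hin : Measurable fun y : EuclideanSpace ℝ (Fin m) => inner ℝ t y := by fun_prop
    -- Cramér–Wold: the characteristic function at `t` is that of the projection on `t` at `1`, so
    -- the scalar theorem suffices.
    have hclt := tendstoInDistribution_inv_sqrt_mul_sum_sub (P := μ)
      (X := fun k ω => inner ℝ t (W k ω)) (Y := id)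
      (P' := gaussianReal 0 (Var[fun ω => inner ℝ t (W 0 ω); μ]).toNNReal)
      HasLaw.id (hL2.const_inner t) (hindep.comp (fun _ y => inner ℝ t y) fun _ => hin)
      (fun i => (hident i).comp hin)
    have h1 := ProbabilityMeasure.tendsto_iff_tendsto_charFun.1 hclt.tendsto 1
    have hlim : charFun (gaussianReal 0 (Var[fun ω => inner ℝ t (W 0 ω); μ]).toNNReal) 1 =
        charFun (multivariateGaussian 0 C) t := by
      rw [charFun_gaussianReal, charFun_multivariateGaussian hC, inner_zero_right, ← hvar]
      simp [variance_nonneg]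
    have hseq : ∀ n : ℕ, charFun (μ.map fun ω => (Real.sqrt n)⁻¹ *
        (∑ k ∈ Finset.range n, inner ℝ t (W k ω) - n * ∫ ω, inner ℝ t (W 0 ω) ∂μ)) 1 =
        charFun (μ.map fun ω =>
          (Real.sqrt n)⁻¹ • (∑ k ∈ Finset.range n, W k ω - (n : ℝ) • w)) t := by
      intro n
      rw [charFun_apply, charFun_apply, integral_map (hS n) (by fun_prop),
        integral_map (hclt.forall_aemeasurable n) (by fun_prop)]
      congr 1
      ext ω
      congr 3
      rw [hmean, real_inner_comm t, inner_smul_right, inner_sub_right, inner_sum,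
        inner_smul_right]
      simp
    simp only [ProbabilityMeasure.coe_mk, Measure.map_id] at h1 ⊢
    rw [← hlim]
    exact h1.congr hseq

end Gaussian

end

section

/-! ### Multinomial covariance -/

section Multinomial

variable {m : ℕ}

lemma dotProduct_multinomialCov_mulVec (p t : EuclideanSpace ℝ (Fin m)) :
    t ⬝ᵥ multinomialCov p *ᵥ t = ∑ j, t j ^ 2 * p j - (∑ j, t j * p j) ^ 2 := by
  have h1 : t ⬝ᵥ (Matrix.diagonal fun j => p j) *ᵥ t = ∑ j, t j ^ 2 * p j := by
    refine Finset.sum_congr rfl fun j _ => ?_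
    rw [Matrix.mulVec_diagonal]
    ring
  have h2 : t ⬝ᵥ Matrix.vecMulVec (fun j => p j) (fun j => p j) *ᵥ t =
      (∑ j, t j * p j) ^ 2 := by
    rw [Matrix.vecMulVec_mulVec, dotProduct_smul, MulOpposite.smul_eq_mul_unop,
      MulOpposite.unop_op, dotProduct_comm (fun j => p j)]
    exact (sq _).symm
  rw [multinomialCov, Matrix.sub_mulVec, dotProduct_sub, h1, h2]

lemma multinomialCov_posSemidef {p : EuclideanSpace ℝ (Fin m)} (hp : ∀ j, 0 ≤ p j)
    (hs : ∑ j, p j = 1) : (multinomialCov p).PosSemidef := by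
  refine Matrix.PosSemidef.of_dotProduct_mulVec_nonneg ?_ fun t => ?_
  · rw [multinomialCov]
    refine Matrix.IsHermitian.sub (Matrix.isHermitian_diagonal _) ?_
    ext i j
    simp [Matrix.vecMulVec_apply, mul_comm]
  · have h := dotProduct_multinomialCov_mulVec p (WithLp.toLp 2 t)
    rw [star_trivial]
    change 0 ≤ (WithLp.toLp 2 t : EuclideanSpace ℝ (Fin m)) ⬝ᵥ _ *ᵥ _
    rw [h, sub_nonneg]
    -- Cauchy–Schwarz with weights `√p`, whose squares sum to `1`.
    have hc := Finset.sum_mul_sq_le_sq_mul_sq Finset.univ (fun j => t j * Real.sqrt (p j))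
      fun j => Real.sqrt (p j)
    have e1 : ∀ j, t j * Real.sqrt (p j) * Real.sqrt (p j) = t j * p j := fun j => by
      rw [mul_assoc, Real.mul_self_sqrt (hp j)]
    simpa only [e1, mul_pow, Real.sq_sqrt (hp _), hs, mul_one] using hc

end Multinomial

/-! ### Empirical and smoothed arrays on the grid -/

variable {d : ℕ} {r : Fin d → ℕ} {Ω : Type*} {mΩ : MeasurableSpace Ω} {μ : Measure Ω}
  {x : (l : Fin d) → Fin (r l) → ℝ}

lemma gridPoint_injective (hx : ∀ l, StrictMono (x l)) : Function.Injective (gridPoint x) :=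
  fun _ _ h => funext fun l => (hx l).injective (congrFun h l)

lemma range_gridPoint : Set.range (gridPoint x) = Set.pi Set.univ fun l => Set.range (x l) := by
  ext y
  simp only [Set.mem_range, Set.mem_pi, Set.mem_univ, true_implies]
  constructor
  · rintro ⟨i, rfl⟩ l
    exact ⟨i l, rfl⟩
  · intro h
    choose i hi using h
    exact ⟨i, funext hi⟩

lemma pos_of_measure_grid_eq_one {P : Measure (Fin d → ℝ)}
    (hP : P (Set.pi Set.univ fun l => Set.range (x l)) = 1) (l : Fin d) : 0 < r l := by
  rcases Nat.eq_zero_or_pos (r l) with h | h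
  · have : IsEmpty (Fin (r l)) := by
      rw [h]
      infer_instance
    have he : (Set.pi Set.univ fun l => Set.range (x l)) = ∅ :=
      Set.univ_pi_eq_empty (Set.range_eq_empty (x l))
    simp [he] at hP
  · exact h

lemma sum_probArray (hx : ∀ l, StrictMono (x l)) {P : Measure (Fin d → ℝ)}
    [IsProbabilityMeasure P] (hP : P (Set.pi Set.univ fun l => Set.range (x l)) = 1) :
    ∑ i, probArray x P i = 1 := by
  have h : P.real (⋃ i ∈ (Finset.univ : Finset (MultiIndex r)), {gridPoint x i}) =
      ∑ i, P.real {gridPoint x i} := by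
    refine measureReal_biUnion_finset (fun i _ j _ hij => ?_) fun i _ =>
      measurableSet_singleton _
    simpa [Function.onFun] using (gridPoint_injective hx).ne hij
  unfold probArray
  rw [← h]
  have e : (⋃ i ∈ (Finset.univ : Finset (MultiIndex r)), {gridPoint x i}) =
      Set.pi Set.univ fun l => Set.range (x l) := by
    rw [← range_gridPoint]
    ext y
    simp [eq_comm]
  rw [e, measureReal_def, hP, ENNReal.toReal_one]

lemma empiricalArray_nonneg (X : ℕ → Ω → Fin d → ℝ) (n : ℕ) (ω : Ω) (i : MultiIndex r) :
    0 ≤ empiricalArray x X n ω i := by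
  unfold empiricalArray
  refine mul_nonneg (by positivity) (Finset.sum_nonneg fun k _ => ?_)
  split_ifs <;> norm_num

lemma empiricalArray_le_one (X : ℕ → Ω → Fin d → ℝ) (n : ℕ) (ω : Ω) (i : MultiIndex r) :
    empiricalArray x X n ω i ≤ 1 := by
  classical
  unfold empiricalArray
  have h : (∑ k ∈ Finset.range n, if X k ω = gridPoint x i then (1 : ℝ) else 0) ≤ n := by
    calc _ ≤ ∑ k ∈ Finset.range n, (1 : ℝ) :=
          Finset.sum_le_sum fun k _ => by split_ifs <;> norm_num
      _ = n := by simp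
  calc _ ≤ 1 / (n : ℝ) * n := by
        refine mul_le_mul_of_nonneg_left ?_ (by positivity)
        convert h
    _ ≤ 1 := by
        rw [one_div]
        exact inv_mul_le_one

lemma smoothedArray_pos (X : ℕ → Ω → Fin d → ℝ) (n : ℕ) (ω : Ω)
    (i : MultiIndex r) : 0 < smoothedArray Finset.univ x X n ω i := by
  have : Nonempty (MultiIndex r) := ⟨i⟩
  have h1 : 0 < uniformArray (Finset.univ : Finset (MultiIndex r)) i := by
    simp only [uniformArray, Finset.mem_univ, if_true]
    have : 0 < (Finset.univ : Finset (MultiIndex r)).card := Finset.card_pos.2 Finset.univ_nonempty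
    positivity
  have h2 := empiricalArray_nonneg (x := x) X n ω i
  unfold smoothedArray
  positivity

/-- Every function of the empirical array is measurable. -/
lemma aemeasurable_comp_empiricalArray {E : Type*} [MeasurableSpace E] {X : ℕ → Ω → Fin d → ℝ}
    (hX : ∀ k, AEMeasurable (X k) μ) (n : ℕ) (Φ : RealArray r → E) :
    AEMeasurable (fun ω => Φ (empiricalArray x X n ω)) μ := by
  classical
  -- The empirical array factors through the finite pattern of cells hit, on which every function is
  -- measurable. Thus no regularity of the copula map away from `p` is needed.
  let J : Ω → Fin n → MultiIndex r → Prop := fun ω k i => X k ω = gridPoint x i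
  have hJ : AEMeasurable J μ := by
    refine aemeasurable_pi_lambda _ fun k => aemeasurable_pi_lambda _ fun i => ?_
    have hm : Measurable fun y : Fin d → ℝ => y = gridPoint x i :=
      measurableSet_setOfPred.1 (measurableSet_singleton (gridPoint x i))
    exact hm.comp_aemeasurable (hX k)
  let H : (Fin n → MultiIndex r → Prop) → RealArray r := fun a i =>
    1 / (n : ℝ) * ∑ k, if a k i then (1 : ℝ) else 0
  have hH : ∀ ω, empiricalArray x X n ω = H (J ω) := by
    intro ω
    ext i
    simp only [empiricalArray, H, J]
    rw [Finset.sum_range]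
    congr!
  have hΦ : Measurable (Φ ∘ H) := measurable_of_finite _
  have := hΦ.comp_aemeasurable hJ
  simpa only [Function.comp_def, ← hH] using this

/-- The vectorised indicators of the cells. -/
def cellVector (x : (l : Fin d) → Fin (r l) → ℝ) (y : Fin d → ℝ) :
    EuclideanSpace ℝ (Fin (∏ l, r l)) :=
  vec fun i => Set.indicator {gridPoint x i} (fun _ => (1 : ℝ)) y

lemma measurable_cellVector : Measurable (cellVector x) := by
  refine (PiLp.continuous_toLp 2 _).measurable.comp (measurable_pi_lambda _ fun j => ?_)
  exact measurable_const.indicator (measurableSet_singleton _)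

lemma inner_cellVector (t : EuclideanSpace ℝ (Fin (∏ l, r l))) (y : Fin d → ℝ) :
    inner ℝ t (cellVector x y) = ∑ j, t j *
      Set.indicator {gridPoint x (finPiFinEquiv.symm j)} (fun _ => (1 : ℝ)) y := by
  simp [PiLp.inner_apply, cellVector, mul_comm]

/-- Distinct cells are disjoint, so the square has no cross terms; this gives the second moments. -/
lemma inner_cellVector_sq (hx : ∀ l, StrictMono (x l))
    (t : EuclideanSpace ℝ (Fin (∏ l, r l))) (y : Fin d → ℝ) :
    (inner ℝ t (cellVector x y) : ℝ) ^ 2 = ∑ j, t j ^ 2 *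
      Set.indicator {gridPoint x (finPiFinEquiv.symm j)} (fun _ => (1 : ℝ)) y := by
  rw [inner_cellVector]
  by_cases hy : ∃ j, y = gridPoint x (finPiFinEquiv.symm j : MultiIndex r)
  · obtain ⟨j, rfl⟩ := hy
    have hj : ∀ i, i ≠ j → gridPoint x (finPiFinEquiv.symm j) ≠
        gridPoint x (finPiFinEquiv.symm i) := fun i hij h =>
      hij (finPiFinEquiv.symm.injective (gridPoint_injective hx h)).symm
    rw [Finset.sum_eq_single j (fun i _ hij => by simp [hj i hij]) (by simp),
      Finset.sum_eq_single j (fun i _ hij => by simp [hj i hij]) (by simp)]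
    simp
  · push Not at hy
    simp [hy]

lemma integral_sum_mul_indicator {P : Measure (Fin d → ℝ)} [IsProbabilityMeasure P]
    (c : Fin (∏ l, r l) → ℝ) :
    ∫ y, ∑ j, c j * Set.indicator {gridPoint x (finPiFinEquiv.symm j)} (fun _ => (1 : ℝ)) y ∂P =
      ∑ j, c j * vec (probArray x P) j := by
  rw [integral_finsetSum]
  · refine Finset.sum_congr rfl fun j _ => ?_
    rw [integral_const_mul, integral_indicator_const _ (measurableSet_singleton _)]
    simp [probArray]
  · intro j _
    exact ((integrable_const (1 : ℝ)).indicator (measurableSet_singleton _)).const_mul _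

lemma norm_cellVector_le (y : Fin d → ℝ) :
    ‖cellVector x y‖ ≤ Real.sqrt (∏ l, r l : ℕ) := by
  rw [EuclideanSpace.norm_eq]
  refine Real.sqrt_le_sqrt ?_
  calc _ ≤ ∑ _j : Fin (∏ l, r l), (1 : ℝ) := by
        refine Finset.sum_le_sum fun j _ => ?_
        by_cases h : y = gridPoint x (finPiFinEquiv.symm j) <;> simp [cellVector, h]
    _ = _ := by simp

variable [IsProbabilityMeasure μ] {P : Measure (Fin d → ℝ)} [IsProbabilityMeasure P]

lemma sqrt_smul_empiricalArray_sub (X : ℕ → Ω → Fin d → ℝ) (p : EuclideanSpace ℝ (Fin (∏ l, r l)))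
    (n : ℕ) (ω : Ω) :
    Real.sqrt n • (vec (empiricalArray x X n ω) - p) =
      (Real.sqrt n)⁻¹ • (∑ k ∈ Finset.range n, cellVector x (X k ω) - (n : ℝ) • p) := by
  have hvec : (n : ℝ) • vec (empiricalArray x X n ω) =
      ∑ k ∈ Finset.range n, cellVector x (X k ω) := by
    rcases Nat.eq_zero_or_pos n with rfl | hn
    · simp
    · ext j
      have : (n : ℝ) ≠ 0 := by positivity
      simp only [PiLp.smul_apply, vec_apply, empiricalArray, smul_eq_mul, WithLp.ofLp_sum,
        Finset.sum_apply]
      rw [one_div, mul_inv_cancel_left₀ this]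
      refine Finset.sum_congr rfl fun k _ => ?_
      simp [cellVector, Set.indicator_apply]
  rw [← hvec, ← smul_sub, smul_smul]
  congr 1
  rcases Nat.eq_zero_or_pos n with rfl | hn
  · simp
  · have : Real.sqrt n ≠ 0 := by positivity
    rw [eq_inv_mul_iff_mul_eq₀ this, Real.mul_self_sqrt (by positivity)]

lemma tendstoInDistribution_empiricalArray (hx : ∀ l, StrictMono (x l))
    (hP : P (Set.pi Set.univ fun l => Set.range (x l)) = 1) {X : ℕ → Ω → Fin d → ℝ}
    (hX : ∀ k, HasLaw (X k) P μ) (hindep : iIndepFun X μ) :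
    TendstoInDistribution
      (fun (n : ℕ) ω => Real.sqrt n • (vec (empiricalArray x X n ω) - vec (probArray x P))) atTop
      (id : EuclideanSpace ℝ (Fin (∏ l, r l)) → _) (fun _ => μ)
      (multivariateGaussian 0 (multinomialCov (vec (probArray x P)))) := by
  simp only [sqrt_smul_empiricalArray_sub]
  have hmean : ∀ t : EuclideanSpace ℝ (Fin (∏ l, r l)),
      ∫ ω, inner ℝ t (cellVector x (X 0 ω)) ∂μ = ∑ j, t j * vec (probArray x P) j := by
    intro t
    rw [← integral_sum_mul_indicator]
    simp only [← inner_cellVector]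
    exact (hX 0).integral_comp (f := fun y => inner ℝ t (cellVector x y))
      ((measurable_cellVector.const_inner).aestronglyMeasurable)
  have hL2 : MemLp (fun ω => cellVector x (X 0 ω)) 2 μ :=
    MemLp.of_bound (measurable_cellVector.comp_aemeasurable
      (hX 0).aemeasurable).aestronglyMeasurable _ (ae_of_all _ fun _ => norm_cellVector_le _)
  refine tendstoInDistribution_multivariate_clt (W := fun k ω => cellVector x (X k ω))
    (multinomialCov_posSemidef (fun j => measureReal_nonneg) ?_)
    (hindep.comp (fun _ => cellVector x) fun _ => measurable_cellVector)
    (fun i => ?_) hL2 (fun t => ?_) (fun t => ?_)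
  · rw [← sum_probArray hx hP]
    exact Equiv.sum_comp finPiFinEquiv.symm fun i => probArray x P i
  · have : IdentDistrib (X i) (X 0) μ μ :=
      ⟨(hX i).aemeasurable, (hX 0).aemeasurable, (hX i).map_eq.trans (hX 0).map_eq.symm⟩
    exact this.comp measurable_cellVector
  · rw [hmean]
    simp [PiLp.inner_apply, mul_comm]
  · rw [variance_eq_sub (hL2.const_inner t), hmean, dotProduct_multinomialCov_mulVec]
    congr 1
    have h := integral_sum_mul_indicator (x := x) (P := P) fun j => t j ^ 2
    simp only [← inner_cellVector_sq hx] at h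
    rw [← h]
    exact (hX 0).integral_comp (f := fun y => (inner ℝ t (cellVector x y) : ℝ) ^ 2)
      ((measurable_cellVector.const_inner.pow_const 2).aestronglyMeasurable)

lemma tendsto_sqrt_div_succ :
    Tendsto (fun n : ℕ => Real.sqrt n / ((n : ℝ) + 1)) atTop (𝓝 0) := by
  have h : Tendsto (fun n : ℕ => (Real.sqrt n)⁻¹) atTop (𝓝 0) :=
    (Real.tendsto_sqrt_atTop.comp tendsto_natCast_atTop_atTop).inv_tendsto_atTop
  refine squeeze_zero (fun n => by positivity) (fun n => ?_) h
  rcases Nat.eq_zero_or_pos n with rfl | hn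
  · simp
  · have : 0 < Real.sqrt n := by positivity
    rw [div_le_iff₀ (by positivity), ← div_eq_inv_mul, le_div_iff₀ this,
      Real.mul_self_sqrt (by positivity)]
    linarith

/-- Slutsky's argument: smoothing changes the scaled array by `√n / (n + 1)` times a bounded vector.
-/
lemma tendstoInDistribution_smoothedArray (S : Finset (MultiIndex r)) {X : ℕ → Ω → Fin d → ℝ}
    (hX : ∀ k, AEMeasurable (X k) μ) {p : EuclideanSpace ℝ (Fin (∏ l, r l))}
    {ν : Measure (EuclideanSpace ℝ (Fin (∏ l, r l)))} [IsProbabilityMeasure ν]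
    (h : TendstoInDistribution
      (fun (n : ℕ) ω => Real.sqrt n • (vec (empiricalArray x X n ω) - p)) atTop
      (id : EuclideanSpace ℝ (Fin (∏ l, r l)) → _) (fun _ => μ) ν) :
    TendstoInDistribution
      (fun (n : ℕ) ω => Real.sqrt n • (vec (smoothedArray S x X n ω) - p)) atTop
      (id : EuclideanSpace ℝ (Fin (∏ l, r l)) → _) (fun _ => μ) ν := by
  have hm : ∀ n : ℕ, AEMeasurable
      (fun ω => Real.sqrt n • (vec (smoothedArray S x X n ω) - p)) μ := fun n =>
    aemeasurable_comp_empiricalArray hX n fun a => Real.sqrt n •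
      (vec (fun i => (n : ℝ) / (n + 1) * a i + 1 / ((n : ℝ) + 1) * uniformArray S i) - p)
  refine tendstoInDistribution_of_tendstoInMeasure_sub _ _ h ?_ hm
  refine tendstoInMeasure_of_tendsto_ae
    (fun n => ((hm n).sub (h.forall_aemeasurable n)).aestronglyMeasurable)
    (ae_of_all _ fun ω => ?_)
  have hb : ∀ n j, |vec (uniformArray S) j - vec (empiricalArray x X n ω) j| ≤
      |vec (uniformArray S) j| + 1 := by
    intro n j
    refine (abs_sub _ _).trans (add_le_add_right ?_ _)
    rw [vec_apply, abs_of_nonneg (empiricalArray_nonneg X n ω _)]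
    exact empiricalArray_le_one X n ω _
  have hpi : Tendsto (fun (n : ℕ) (j : Fin (∏ l, r l)) => Real.sqrt n / ((n : ℝ) + 1) *
      (vec (uniformArray S) j - vec (empiricalArray x X n ω) j)) atTop (𝓝 0) := by
    refine tendsto_pi_nhds.2 fun j => ?_
    refine squeeze_zero_norm (a := fun n : ℕ => Real.sqrt n / ((n : ℝ) + 1) *
      (|vec (uniformArray S) j| + 1)) (fun n => ?_) ?_
    · rw [norm_mul, Real.norm_of_nonneg (by positivity)]
      exact mul_le_mul_of_nonneg_left (hb n j) (by positivity)
    · simpa using tendsto_sqrt_div_succ.mul_const (|vec (uniformArray S) j| + 1)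
  have hlim := ((PiLp.continuous_toLp 2 _).tendsto _).comp hpi
  refine hlim.congr fun n => PiLp.ext fun j => ?_
  have : (n : ℝ) + 1 ≠ 0 := by positivity
  simp only [Function.comp_apply, Pi.sub_apply, PiLp.sub_apply, PiLp.smul_apply, smul_eq_mul,
    vec_apply, smoothedArray]
  field_simp
  ring

end

/-! ### Asymptotic normality of the empirical copula array -/

section

variable {d : ℕ} {r : Fin d → ℕ} {Ω : Type*} {mΩ : MeasurableSpace Ω} {μ : Measure Ω}
  {x : (l : Fin d) → Fin (r l) → ℝ} [IsProbabilityMeasure μ] {k : ℕ}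

/-- Asymptotic normality of the empirical copula array. -/
theorem rootNAsymptoticNormal_empiricalCopulaArray (hd : 1 ≤ d) (hr : ∀ l, 0 < r l)
    {p : RealArray r} (hp : ∀ i, 0 < p i) (S : Finset (MultiIndex r))
    {X : ℕ → Ω → Fin d → ℝ} (hX : ∀ k, AEMeasurable (X k) μ)
    (b : Module.Basis (Fin k) ℝ (nullMarginArrays (Finset.univ : Finset (MultiIndex r))))
    (h : RootNAsymptoticNormal μ (fun n ω => vec (smoothedArray S x X n ω)) (vec p)
      (multinomialCov (vec p))) :
    RootNAsymptoticNormal μ (fun n ω => vec (empiricalCopulaArray S x X n ω))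
      (vec (copulaArray p)) (sandwichCov (basisMatrix b) (vec (copulaArray p)) (vec p)) := by
  have hg := (isIProjection_copulaArray hd hr hp).pos hd hr hp
  have hpv : ∀ j, 0 < vec p j := fun j => hp _
  have hgv : ∀ j, 0 < vec (copulaArray p) j := fun j => hg _
  refine ⟨sandwichCov_posSemidef _ hgv hpv, ?_⟩
  have hm : ∀ n : ℕ, AEMeasurable (fun ω => Real.sqrt n •
      (vec (copulaArray (unvec r (vec (smoothedArray S x X n ω)))) -
        vec (copulaArray (unvec r (vec p))))) μ := fun n =>
    aemeasurable_comp_empiricalArray hX n fun a => Real.sqrt n • (vec (copulaArray (unvec r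
      (vec fun i => (n : ℝ) / (n + 1) * a i + 1 / ((n : ℝ) + 1) * uniformArray S i))) -
        vec (copulaArray (unvec r (vec p))))
  have hdelta := tendstoInDistribution_delta h.2 (hasFDerivAt_vec_copulaArray b hd hr hp) hm
  simp only [unvec_vec] at hdelta
  have hmap := map_toEuclideanCLM_multivariateGaussian h.1
    (projectionJacobian (basisMatrix b) (vec (copulaArray p)) (vec p))
  rw [projectionJacobian_mul_multinomialCov_mul _ hgv hpv
    (basisMatrix_transpose_mulVec_one b hd)] at hmap
  refine ⟨hdelta.forall_aemeasurable, aemeasurable_id, ?_⟩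
  have ht := hdelta.tendsto
  simp only [Function.comp_id, hmap] at ht
  simp only [Measure.map_id]
  exact ht

end

end DiscreteCopula

end

open DiscreteCopula in
theorem mainTheorem7 {d : ℕ} (hd : 1 ≤ d) (r : Fin d → ℕ)
    -- the possible values of the components, in increasing order
    (x : (l : Fin d) → Fin (r l) → ℝ) (hx : ∀ l, StrictMono (x l))
    -- the distribution, carried by the grid, with full support
    (P : Measure (Fin d → ℝ)) [IsProbabilityMeasure P]
    (hP : P (Set.pi Set.univ fun l => Set.range (x l)) = 1)
    (hsupp : arraySupport (probArray x P) = Finset.univ)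
    -- the sample (not necessarily independent)
    {Ω : Type*} [MeasurableSpace Ω] (μ : Measure Ω) [IsProbabilityMeasure μ]
    (X : ℕ → Ω → Fin d → ℝ) (hX : ∀ k, HasLaw (X k) P μ)
    -- a basis of the space of arrays with null margins
    {k : ℕ} (b : Module.Basis (Fin k) ℝ
      (nullMarginArrays (Finset.univ : Finset (MultiIndex r)))) :
    -- the copula array of `p` is well defined and has full support
    (∃! g, IsIProjection (copulaArrays r) (probArray x P) g) ∧
    IsIProjection (copulaArrays r) (probArray x P) (copulaArray (probArray x P)) ∧
    arraySupport (copulaArray (probArray x P)) = Finset.univ ∧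
    -- almost surely, all the empirical copula arrays are well defined
    (∀ᵐ ω ∂μ, ∀ n, ∃! g, IsIProjection (copulaArrays r)
      (smoothedArray (arraySupport (probArray x P)) x X n ω) g) ∧
    -- the inverted matrix is invertible
    IsUnit (weightedGram (basisMatrix b) (vec (copulaArray (probArray x P)))) ∧
    -- asymptotic normality
    (RootNAsymptoticNormal μ
        (fun n ω => vec (smoothedArray (arraySupport (probArray x P)) x X n ω))
        (vec (probArray x P)) (multinomialCov (vec (probArray x P))) →
      RootNAsymptoticNormal μ
        (fun n ω => vec (empiricalCopulaArray (arraySupport (probArray x P)) x X n ω))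
        (vec (copulaArray (probArray x P)))
        (sandwichCov (basisMatrix b) (vec (copulaArray (probArray x P)))
          (vec (probArray x P)))) ∧
    -- its premise holds for an independent sample, hence so does its conclusion
    (iIndepFun X μ →
      RootNAsymptoticNormal μ
        (fun n ω => vec (smoothedArray (arraySupport (probArray x P)) x X n ω))
        (vec (probArray x P)) (multinomialCov (vec (probArray x P)))) := by
  have hr := pos_of_measure_grid_eq_one hP
  have hp : ∀ i, 0 < probArray x P i := fun i =>
    measureReal_nonneg.lt_of_ne' (arraySupport_eq_univ_iff.1 hsupp i)
  have hXm : ∀ k, AEMeasurable (X k) μ := fun k => (hX k).aemeasurable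
  have hproj := isIProjection_copulaArray hd hr hp
  have hg := hproj.pos hd hr hp
  rw [hsupp]
  refine ⟨existsUnique_isIProjection hd hr hp, hproj,
    arraySupport_eq_univ_iff.2 fun i => (hg i).ne', ?_, ?_, ?_, ?_⟩
  -- The uniform component keeps every entry positive for every outcome, including at `n = 0`.
  · exact ae_of_all _ fun ω n => existsUnique_isIProjection hd hr (smoothedArray_pos X n ω)
  · exact (weightedGram_posDef (basisMatrix_mulVec_injective b)
      (v := vec (copulaArray (probArray x P))) fun j => hg _).isUnit
  · exact rootNAsymptoticNormal_empiricalCopulaArray hd hr hp _ hXm b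
  · intro hindep
    refine ⟨multinomialCov_posSemidef (fun j => (hp _).le) ?_,
      tendstoInDistribution_smoothedArray _ hXm
        (tendstoInDistribution_empiricalArray hx hP hX hindep)⟩
    rw [← sum_probArray hx hP]
    exact Equiv.sum_comp finPiFinEquiv.symm fun i => probArray x P i
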